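/- **Setting.** Let $M$ be a smooth manifold and $n\ge 1$. Let $(M,\omega)$ be pre-$n$-plectic, that is, $\omega\in\Omega^{n+1}(M)$ is closed. A form $H\in\Omega^{n-1}(M)$ is Hamiltonian, written $H\in\Omega^{n-1}_{\mathrm{Ham}}(M)$, if there is a vector field $v_H$ (a Hamiltonian vector field of $H$) with $dH=-\iota_{v_H}\omega$. Put $\varsigma(k)=-(-1)^{k(k+1)/2}$. Let $\mathfrak g$ be a real Lie algebra and let $v:\mathfrak g\to\mathfrak X(M)$, $x\mapsto v_x$, be a multisymplectic infinitesimal action, i.e. a Lie algebra homomorphism with $\mathcal L_{v_x}\omega=0$ for all $x$. For $p=x_1\wedge\dots\wedge x_k\in\Lambda^k\mathfrak g$ set $\iota(v_p)=\iota_{v_{x_k}}\cdots\iota_{v_{x_1}}$, extended linearly to all $p\in\Lambda^k\mathfrak g$. Let $$\partial_k:\Lambda^k\mathfrak g\to\Lambda^{k-1}\mathfrak g,\qquad \partial_k(x_1\wedge\dots\wedge x_k)=\sum_{1\le i<j\le k}(-1)^{i+j}[x_i,x_j]\wedge x_1\wedge\cdots\wedge\widehat{x_i}\wedge\cdots\wedge\widehat{x_j}\wedge\cdots\wedge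 x_k ,$$ be the Lie algebra homology differential, and $Z_k(\mathfrak g)=\ker\partial_k$. A homotopy co-momentum map for $v$ is a family $(f)$ of linear maps $f_k:\Lambda^k\mathfrak g\to\Omega^{n-k}(M)$, $1\le k\le n$, with $f_1(\mathfrak g)\subset\Omega^{n-1}_{\mathrm{Ham}}(M)$, with $d f_1(x)=-\iota_{v_x}\omega$ for all $x\in\mathfrak g$, and with $$-f_{k-1}(\partial_k p)=d f_k(p)+\varsigma(k)\,\iota(v_p)\omega\qquad\text{for all } 1\le k\le n+1,\ p\in\Lambda^k\mathfrak g,$$ where $f_0=0$ and $f_{n+1}=0$. **Proposition.** Let $(M,\omega)$ be a pre-$n$-plectic manifold, $H\in\Omega^{n-1}_{\mathrm{Ham}}(M)$, and $v_H$ any Hamiltonian vector field of $H$. Let $(f)$ be a homotopy co-momentum map for a multisymplectic infinitesimal action $v$ of $\mathfrak g$ which strictly preserves $H$, i.e. $\mathcal L_{v_x}H=0$ for all $x\in\mathfrak g$. Then for every $1\le k\le n$ and every $p\in Z_k(\mathfrak g)$ the form $f_k(p)$ is globally conserved by $v_H$, i.e. $\mathcal L_{v_H}f_k(p)$ is exact.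 Explicitly, $$\mathcal L_{v_H}f_k(p)=d\bigl(\iota_{v_H}f_k(p)+\varsigma(k)\,\iota(v_p)H\bigr).$$ (Forms of negative degree are zero; so for $k=n$ this says $\mathcal L_{v_H}f_n(p)=0$.) -/

import Mathlib

open scoped Manifold

noncomputable section

namespace Multisymplectic

section LieHomology

open ExteriorAlgebra

/-- Removing entry `j + 1` and then the head is the same as removing entry `j` of the tail. -/
lemma vecTail_succ_removeNth {α : Type*} {k : ℕ} (j : Fin (k + 1)) (y : Fin (k + 2) → α) :
    Matrix.vecTail (j.succ.removeNth y) = j.removeNth (Matrix.vecTail y) := by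
  ext i
  simp [Fin.removeNth, Matrix.vecTail]

variable (𝔤 : Type*) [LieRing 𝔤] [LieAlgebra ℝ 𝔤]

/-- Recursion step for `adExt`. -/
def adStep : 𝔤 →ₗ[ℝ] ExteriorAlgebra ℝ 𝔤 × (𝔤 →ₗ[ℝ] ExteriorAlgebra ℝ 𝔤) →ₗ[ℝ]
    (𝔤 →ₗ[ℝ] ExteriorAlgebra ℝ 𝔤) :=
  LinearMap.mk₂ ℝ
    (fun y qn =>
      { toFun := fun x => ι ℝ ⁅x, y⁆ * qn.1 + ι ℝ y * qn.2 x
        map_add' := fun x x' => by simp [add_mul, mul_add]; abel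
        map_smul' := fun c x => by simp })
    (fun y y' qn => by ext x; simp [add_mul]; abel)
    (fun c y qn => by ext x; simp)
    (fun y qn qn' => by ext x; simp [mul_add]; abel)
    (fun c y qn => by ext x; simp)

/-- `adExt 𝔤 q x = [x, q]`: the extension of `ad x` to a derivation of the exterior algebra, given by
`[x, 1] = 0` and `[x, y ∧ q] = [x, y] ∧ q + y ∧ [x, q]`. -/
def adExt : ExteriorAlgebra ℝ 𝔤 →ₗ[ℝ] 𝔤 →ₗ[ℝ] ExteriorAlgebra ℝ 𝔤 :=
  CliffordAlgebra.foldr' (0 : QuadraticForm ℝ 𝔤) (adStep 𝔤)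
    (fun y q n => by
      ext x
      have h := ι_add_mul_swap (R := ℝ) ⁅x, y⁆ y
      have h2 := ι_sq_zero (R := ℝ) y
      change ι ℝ ⁅x, y⁆ * (ι ℝ y * q) + ι ℝ y * (ι ℝ ⁅x, y⁆ * q + ι ℝ y * n x) = _
      rw [mul_add, ← mul_assoc, ← mul_assoc, ← mul_assoc, h2, ← add_assoc, ← add_mul, h]
      simp)
    0

lemma adExt_one (x : 𝔤) : adExt 𝔤 1 x = 0 := by
  have := CliffordAlgebra.foldr'_algebraMap (0 : QuadraticForm ℝ 𝔤) (adStep 𝔤) (by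
      intro y q n
      ext x
      have h := ι_add_mul_swap (R := ℝ) ⁅x, y⁆ y
      have h2 := ι_sq_zero (R := ℝ) y
      change ι ℝ ⁅x, y⁆ * (ι ℝ y * q) + ι ℝ y * (ι ℝ ⁅x, y⁆ * q + ι ℝ y * n x) = _
      rw [mul_add, ← mul_assoc, ← mul_assoc, ← mul_assoc, h2, ← add_assoc, ← add_mul, h]
      simp) 0 1
  simpa [adExt] using congrArg (· x) this

lemma adExt_ι_mul (x y : 𝔤) (q : ExteriorAlgebra ℝ 𝔤) :
    adExt 𝔤 (ι ℝ y * q) x = ι ℝ ⁅x, y⁆ * q + ι ℝ y * adExt 𝔤 q x :=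
  congrArg (· x) (CliffordAlgebra.foldr'_ι_mul (0 : QuadraticForm ℝ 𝔤) (adStep 𝔤) _ 0 y q)

/-- Recursion step for `lieDiff`. -/
def lieDiffStep : 𝔤 →ₗ[ℝ] ExteriorAlgebra ℝ 𝔤 × ExteriorAlgebra ℝ 𝔤 →ₗ[ℝ] ExteriorAlgebra ℝ 𝔤 :=
  LinearMap.mk₂ ℝ (fun x qn => - (ι ℝ x * qn.2) - adExt 𝔤 qn.1 x)
    (fun y y' qn => by simp [add_mul]; abel)
    (fun c y qn => by simp [smul_sub])
    (fun y qn qn' => by simp [mul_add]; abel)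
    (fun c y qn => by simp [smul_sub])

/-- The Lie algebra homology differential on the whole exterior algebra, constructed by
`∂ 1 = 0` and `∂ (x ∧ q) = - x ∧ ∂ q - [x, q]`. Its usual closed formula is `lieDiff_ιMulti`. -/
def lieDiff : ExteriorAlgebra ℝ 𝔤 →ₗ[ℝ] ExteriorAlgebra ℝ 𝔤 :=
  CliffordAlgebra.foldr' (0 : QuadraticForm ℝ 𝔤) (lieDiffStep 𝔤)
    (fun x q n => by
      have h2 := ι_sq_zero (R := ℝ) x
      change - (ι ℝ x * (- (ι ℝ x * n) - adExt 𝔤 q x)) - adExt 𝔤 (ι ℝ x * q) x = _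
      rw [adExt_ι_mul, mul_sub, mul_neg, ← mul_assoc, h2]
      simp)
    0

lemma lieDiff_one : lieDiff 𝔤 1 = 0 := by
  have := CliffordAlgebra.foldr'_algebraMap (0 : QuadraticForm ℝ 𝔤) (lieDiffStep 𝔤) (by
      intro x q n
      have h2 := ι_sq_zero (R := ℝ) x
      change - (ι ℝ x * (- (ι ℝ x * n) - adExt 𝔤 q x)) - adExt 𝔤 (ι ℝ x * q) x = _
      rw [adExt_ι_mul, mul_sub, mul_neg, ← mul_assoc, h2]
      simp) 0 1
  simpa [lieDiff] using this

lemma lieDiff_ι_mul (x : 𝔤) (q : ExteriorAlgebra ℝ 𝔤) :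
    lieDiff 𝔤 (ι ℝ x * q) = - (ι ℝ x * lieDiff 𝔤 q) - adExt 𝔤 q x :=
  CliffordAlgebra.foldr'_ι_mul (0 : QuadraticForm ℝ 𝔤) (lieDiffStep 𝔤) _ 0 x q

/-- `θ_x (y_0 ∧ ⋯ ∧ y_{k}) = ∑ j (-1)^j [x,y_j] ∧ (remove j)`. -/
lemma adExt_ιMulti (k : ℕ) (x : 𝔤) (y : Fin (k + 1) → 𝔤) :
    adExt 𝔤 (ιMulti ℝ (k + 1) y) x =
      ∑ j : Fin (k + 1), (-1 : ℝ) ^ (j : ℕ) • (ι ℝ ⁅x, y j⁆ * ιMulti ℝ k (j.removeNth y)) := by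
  induction k with
  | zero =>
    rw [ιMulti_succ_apply, adExt_ι_mul]
    simp [adExt_one]
  | succ k ih =>
    rw [ιMulti_succ_apply, adExt_ι_mul, ih, Finset.mul_sum, Fin.sum_univ_succ (n := k + 1)]
    congr 1
    · simp; rfl
    · refine Finset.sum_congr rfl fun j _ => ?_
      have h := ι_add_mul_swap (R := ℝ) (y 0) ⁅x, y j.succ⁆
      have h' : ι ℝ (y 0) * ι ℝ ⁅x, y j.succ⁆ = - (ι ℝ ⁅x, y j.succ⁆ * ι ℝ (y 0)) :=
        eq_neg_of_add_eq_zero_left h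
      rw [ιMulti_succ_apply (v := j.succ.removeNth y), mul_smul_comm, ← mul_assoc, ← mul_assoc]
      change _ • (ι ℝ (y 0) * ι ℝ ⁅x, y j.succ⁆ * _) = _
      rw [h', Fin.val_succ, pow_succ]
      simp only [neg_mul, smul_neg, mul_neg, mul_one, neg_smul]
      rw [vecTail_succ_removeNth]
      rfl

/-- The defining formula of the Lie algebra homology differential,
`∂ (x_0 ∧ ⋯ ∧ x_{k+1}) = ∑_{a < b} (-1)^(a+b) [x_a, x_b] ∧ x_0 ∧ ⋯ x̂_a ⋯ x̂_b ⋯ ∧ x_{k+1}`;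
the pairs `a < b` are written as `a = i`, `b = j + 1` with `i ≤ j`. -/
theorem lieDiff_ιMulti (k : ℕ) (x : Fin (k + 2) → 𝔤) :
    lieDiff 𝔤 (ιMulti ℝ (k + 2) x) =
      ∑ i : Fin (k + 1), ∑ j ≥ i, (-1 : ℝ) ^ (i + (j + 1) : ℕ) •
        (ι ℝ ⁅x i.castSucc, x j.succ⁆ *
          ιMulti ℝ k (j.removeNth (i.castSucc.removeNth x))) := by
  induction k with
  | zero =>
    rw [ιMulti_succ_apply, lieDiff_ι_mul, adExt_ιMulti, ιMulti_succ_apply, lieDiff_ι_mul]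
    simp [lieDiff_one, adExt_one]
    rfl
  | succ k ih =>
    rw [ιMulti_succ_apply, lieDiff_ι_mul, adExt_ιMulti, ih]
    conv_rhs => rw [Fin.sum_univ_succ (n := k + 1), add_comm]
    simp only [← Finset.filter_le_eq_Ici, Finset.sum_filter]
    rw [sub_eq_add_neg, Finset.mul_sum, ← Finset.sum_neg_distrib, ← Finset.sum_neg_distrib]
    congr 1
    · refine Finset.sum_congr rfl fun i _ => ?_
      rw [Fin.sum_univ_succ (n := k + 1), if_neg (by simp), zero_add, Finset.mul_sum,
        ← Finset.sum_neg_distrib]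
      refine Finset.sum_congr rfl fun j _ => ?_
      by_cases hij : i ≤ j
      · rw [if_pos hij, if_pos (by simpa using hij)]
        have h := ι_add_mul_swap (R := ℝ) (x 0) ⁅x i.castSucc.succ, x j.succ.succ⁆
        have h' := eq_neg_of_add_eq_zero_left h
        rw [ιMulti_succ_apply (v := (j.succ.removeNth (i.succ.castSucc.removeNth x) : Fin (k + 1) → 𝔤)),
          mul_smul_comm, ← mul_assoc, ← mul_assoc]
        change - (_ • (ι ℝ (x 0) * ι ℝ ⁅x i.castSucc.succ, x j.succ.succ⁆ * _)) = _
        rw [h', Fin.val_succ, Fin.val_succ,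
          show (i : ℕ) + 1 + ((j : ℕ) + 1 + 1) = (i : ℕ) + ((j : ℕ) + 1) + 2 by ring,
          pow_add (-1 : ℝ) ((i : ℕ) + ((j : ℕ) + 1)) 2, neg_one_sq, mul_one]
        simp only [neg_mul, smul_neg, neg_neg]
        rw [vecTail_succ_removeNth, ← Fin.succ_castSucc, vecTail_succ_removeNth]
        rfl
      · rw [if_neg hij, if_neg (by simpa using hij)]
        simp
    · refine Finset.sum_congr rfl fun j _ => ?_
      rw [if_pos (Fin.zero_le _), Fin.val_zero, zero_add, pow_succ]
      simp only [mul_neg, mul_one, neg_smul]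
      rfl

lemma lieDiff_mem (k : ℕ) {p : ExteriorAlgebra ℝ 𝔤} (hp : p ∈ ⋀[ℝ]^k 𝔤) :
    lieDiff 𝔤 p ∈ ⋀[ℝ]^(k - 1) 𝔤 := by
  rw [← ιMulti_span_fixedDegree] at hp
  induction hp using Submodule.span_induction with
  | zero => simp
  | add p q _ _ hp hq => rw [map_add]; exact add_mem hp hq
  | smul c p _ hp => rw [map_smul]; exact Submodule.smul_mem _ c hp
  | mem p hp =>
    obtain ⟨x, rfl⟩ := hp
    match k, x with
    | 0, x => simp [lieDiff_one]
    | 1, x =>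
      rw [ιMulti_succ_apply, lieDiff_ι_mul]
      simp [lieDiff_one, adExt_one]
    | k + 2, x =>
      rw [lieDiff_ιMulti]
      refine Submodule.sum_mem _ fun i _ => Submodule.sum_mem _ fun j _ =>
        Submodule.smul_mem _ _ ?_
      have h := ιMulti_range (M := 𝔤) ℝ (k + 1) ⟨Fin.cons ⁅x i.castSucc, x j.succ⁆
        (j.removeNth (i.castSucc.removeNth x)), rfl⟩
      rw [ιMulti_succ_apply] at h
      exact h

/-- The Lie algebra homology differential `∂_k : Λ^k 𝔤 → Λ^(k-1) 𝔤` (and `∂_0 = 0`). -/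
def lieBoundary (k : ℕ) : ⋀[ℝ]^k 𝔤 →ₗ[ℝ] ⋀[ℝ]^(k - 1) 𝔤 :=
  (lieDiff 𝔤).restrict fun _ hp => lieDiff_mem 𝔤 k hp

/-- The space `Z_k(𝔤) = ker ∂_k` of Lie algebra homology cycles. -/
def lieCycles (k : ℕ) : Submodule ℝ (⋀[ℝ]^k 𝔤) :=
  LinearMap.ker (lieBoundary 𝔤 k)

end LieHomology

section Forms

variable (E : Type*) [NormedAddCommGroup E] [NormedSpace ℝ E]
  (M : Type*) [TopologicalSpace M] [ChartedSpace E M]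

/-- (Not necessarily smooth) vector fields on the manifold `M` modelled on `E`. -/
abbrev VField := ∀ x : M, TangentSpace 𝓘(ℝ, E) x

/-- (Not necessarily smooth) inhomogeneous differential forms on `M`; the component of degree `k`
assigns to a point `x` an alternating `k`-form on `T_x M`. In Mathlib `TangentSpace 𝓘(ℝ, E) x` is by
definition `E` (through the preferred chart at `x`), and this is how the fibre appears here.
Working with all degrees at once gives `Ω^j(M) = 0` for `j < 0` its usual meaning. -/
abbrev Form := ∀ k : ℕ, M → E [⋀^Fin k]→L[ℝ] ℝ

variable {E M}

/-- Smoothness of a vector field, as a section of the tangent bundle. -/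
def VField.IsSmooth [IsManifold 𝓘(ℝ, E) (⊤ : ℕ∞) M] (V : VField E M) : Prop :=
  ContMDiff 𝓘(ℝ, E) 𝓘(ℝ, E).tangent (⊤ : ℕ∞) (fun x => (⟨x, V x⟩ : TangentBundle 𝓘(ℝ, E) M))

/-- The expression of a `k`-form in the chart at `x₀`: its pullback under the inverse chart. -/
def chartForm {k : ℕ} (x₀ : M) (α : M → E [⋀^Fin k]→L[ℝ] ℝ) (y : E) : E [⋀^Fin k]→L[ℝ] ℝ :=
  (α ((extChartAt 𝓘(ℝ, E) x₀).symm y)).compContinuousLinearMap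
    (mfderiv 𝓘(ℝ, E) 𝓘(ℝ, E) (extChartAt 𝓘(ℝ, E) x₀).symm y)

/-- The expression of a vector field in the chart at `x₀`. -/
def chartField (x₀ : M) (V : VField E M) : E → E :=
  VectorField.mpullback 𝓘(ℝ, E) 𝓘(ℝ, E) (extChartAt 𝓘(ℝ, E) x₀).symm V

/-- The value at `x₀` of the pullback to `M`, by the chart at `x₀`, of a form on `E`. -/
def pullChart {k : ℕ} (x₀ : M) (β : E → E [⋀^Fin k]→L[ℝ] ℝ) : E [⋀^Fin k]→L[ℝ] ℝ :=
  (β (extChartAt 𝓘(ℝ, E) x₀ x₀)).compContinuousLinearMap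
    (mfderiv 𝓘(ℝ, E) 𝓘(ℝ, E) (extChartAt 𝓘(ℝ, E) x₀) x₀)

/-- Smoothness of an inhomogeneous form: every component is smooth in charts. -/
def Form.IsSmooth (α : Form E M) : Prop :=
  ∀ (k : ℕ) (x₀ : M), ContDiffOn ℝ (⊤ : ℕ∞) (chartForm x₀ (α k)) (extChartAt 𝓘(ℝ, E) x₀).target

/-- `α ∈ Ω^k(M)`: a smooth form which is homogeneous of degree `k`. -/
structure IsKForm (k : ℕ) (α : Form E M) : Prop where
  smooth : α.IsSmooth
  homogeneous : ∀ m, m ≠ k → α m = 0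

/-- The exterior derivative on a manifold, computed in charts. -/
def d (α : Form E M) : Form E M
  | 0 => 0
  | k + 1 => fun x => pullChart x (extDeriv (chartForm x (α k)))

/-- The Lie derivative of a `k`-form `β` on `E` along a vector field `V`,
`(L_V β)_y (w_1, …, w_k) = (D_V β)_y (w_1, …, w_k) + ∑_i β_y (w_1, …, DV_y w_i, …, w_k)`. -/
def lieDerivModel {k : ℕ} (V : E → E) (β : E → E [⋀^Fin k]→L[ℝ] ℝ) (y : E) :
    E [⋀^Fin k]→L[ℝ] ℝ :=
  fderiv ℝ β y (V y) +
    (β y).fderivCompContinuousLinearMap (ContinuousLinearMap.id ℝ E) (fderiv ℝ V y)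

/-- The Lie derivative of a form along a vector field on a manifold, computed in charts. -/
def lieDeriv (V : VField E M) (α : Form E M) : Form E M :=
  fun k x => pullChart x (lieDerivModel (chartField x V) (chartForm x (α k)))

/-- The contraction `ι_V α = α (V, ·, …, ·)`. -/
def contract (V : VField E M) : Module.End ℝ (Form E M) where
  toFun α := fun k x => (α (k + 1) x).curryLeft (V x)
  map_add' α β := by ext; rfl
  map_smul' c α := by ext; rfl

/-- `α` is exact: it is `dβ` for a smooth form `β`. -/
def IsExact (α : Form E M) : Prop :=
  ∃ β : Form E M, β.IsSmooth ∧ α = d β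

/-- `α` is a globally conserved quantity for `V`: the form `L_V α` is exact. -/
def IsGloballyConserved (V : VField E M) (α : Form E M) : Prop :=
  IsExact (lieDeriv V α)

end Forms

section Actions

variable {E : Type*} [NormedAddCommGroup E] [NormedSpace ℝ E]
  {M : Type*} [TopologicalSpace M] [ChartedSpace E M]
  {𝔤 : Type*} [LieRing 𝔤] [LieAlgebra ℝ 𝔤]

/-- The map `x ↦ ι_{v_x}`, with values in the opposite of the algebra of operators on forms. -/
def contractHom (v : 𝔤 →ₗ[ℝ] VField E M) : 𝔤 →ₗ[ℝ] (Module.End ℝ (Form E M))ᵐᵒᵖ where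
  toFun x := MulOpposite.op (contract (v x))
  map_add' x y := by
    apply MulOpposite.unop_injective
    apply LinearMap.ext
    intro α
    funext k y'
    change (α (k + 1) y').curryLeft (v (x + y) y') = _
    rw [map_add]
    exact ((α (k + 1) y').curryLeft).map_add (v x y') (v y y')
  map_smul' c x := by
    apply MulOpposite.unop_injective
    apply LinearMap.ext
    intro α
    funext k y'
    change (α (k + 1) y').curryLeft (v (c • x) y') = _
    rw [map_smul]
    exact ((α (k + 1) y').curryLeft).map_smul c (v x y')

lemma contractHom_sq (v : 𝔤 →ₗ[ℝ] VField E M) (x : 𝔤) :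
    contractHom v x * contractHom v x = 0 := by
  apply MulOpposite.unop_injective
  apply LinearMap.ext
  intro α
  funext k y
  exact (α (k + 2) y).curryLeft_same _

/-- The contraction `ι(v_p)` for `p ∈ Λ𝔤`: linear in `p`, with
`ι(v_p) = ι_{v_{x_k}} ∘ ⋯ ∘ ι_{v_{x_1}}` for `p = x_1 ∧ ⋯ ∧ x_k`; see `contractMulti_ιMulti`. -/
def contractMulti (v : 𝔤 →ₗ[ℝ] VField E M) (p : ExteriorAlgebra ℝ 𝔤) :
    Module.End ℝ (Form E M) :=
  MulOpposite.unop (ExteriorAlgebra.lift ℝ ⟨contractHom v, contractHom_sq v⟩ p)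

lemma contractMulti_ιMulti (v : 𝔤 →ₗ[ℝ] VField E M) {k : ℕ} (x : Fin (k + 1) → 𝔤) (α : Form E M) :
    contractMulti v (ExteriorAlgebra.ιMulti ℝ (k + 1) x) α =
      contractMulti v (ExteriorAlgebra.ιMulti ℝ k (fun i => x i.succ)) (contract (v (x 0)) α) := by
  rw [ExteriorAlgebra.ιMulti_succ_apply, contractMulti, map_mul, ExteriorAlgebra.lift_ι_apply]
  rfl

/-- The sign `ς(k) = -(-1)^(k(k+1)/2)`. -/
def varsigma (k : ℕ) : ℝ := -(-1) ^ (k * (k + 1) / 2)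

/-- `(M, ω)` is pre-`n`-plectic: `ω` is a closed `(n+1)`-form. -/
structure IsPrePlectic (n : ℕ) (ω : Form E M) : Prop where
  form : IsKForm (n + 1) ω
  closed : d ω = 0

variable [IsManifold 𝓘(ℝ, E) (⊤ : ℕ∞) M]

/-- `V` is a Hamiltonian vector field for `α`: it is smooth and `dα = - ι_V ω`. -/
structure IsHamiltonianField (ω α : Form E M) (V : VField E M) : Prop where
  smooth : V.IsSmooth
  eq : d α = - contract V ω

/-- `α ∈ Ω^{n-1}_Ham(M)`: an `(n-1)`-form with a Hamiltonian vector field. -/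
structure IsHamiltonianForm (n : ℕ) (ω α : Form E M) : Prop where
  form : IsKForm (n - 1) α
  exists_field : ∃ V : VField E M, IsHamiltonianField ω α V

/-- A multisymplectic infinitesimal action: a Lie algebra homomorphism from `𝔤` to the smooth vector
fields, with values in those that preserve `ω`. -/
structure IsMultisymplecticAction (ω : Form E M) (v : 𝔤 →ₗ[ℝ] VField E M) : Prop where
  smooth : ∀ x, (v x).IsSmooth
  map_lie : ∀ x y, v ⁅x, y⁆ = VectorField.mlieBracket 𝓘(ℝ, E) (v x) (v y)
  preserves : ∀ x, lieDeriv (v x) ω = 0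

/-- The action strictly preserves `H`. -/
def IsStrictlyPreserving (v : 𝔤 →ₗ[ℝ] VField E M) (H : Form E M) : Prop :=
  ∀ x, lieDeriv (v x) H = 0

/-- An `L_∞`-morphism from `𝔤` to the Lie `n`-algebra of observables of `(M, ω)`, with components
`f_k : Λ^k 𝔤 → Ω^{n-k}(M)` for `1 ≤ k ≤ n`; the components outside this range are zero. -/
structure IsLInftyMorphism (n : ℕ) (ω : Form E M) (v : 𝔤 →ₗ[ℝ] VField E M)
    (f : ∀ k : ℕ, ⋀[ℝ]^k 𝔤 →ₗ[ℝ] Form E M) : Prop where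
  form : ∀ k, 1 ≤ k → k ≤ n → ∀ p, IsKForm (n - k) (f k p)
  zero : f 0 = 0
  eq_zero_of_lt : ∀ k, n < k → f k = 0
  hamiltonian : ∀ p, IsHamiltonianForm n ω (f 1 p)
  eq : ∀ k, 1 ≤ k → k ≤ n + 1 → ∀ p : ⋀[ℝ]^k 𝔤,
    - f (k - 1) (lieBoundary 𝔤 k p) = d (f k p) + varsigma k • contractMulti v p ω

/-- A homotopy co-momentum map for the action `v` on `(M, ω)`. -/
structure IsComomentumMap (n : ℕ) (ω : Form E M) (v : 𝔤 →ₗ[ℝ] VField E M)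
    (f : ∀ k : ℕ, ⋀[ℝ]^k 𝔤 →ₗ[ℝ] Form E M) : Prop extends IsLInftyMorphism n ω v f where
  moment : ∀ x : 𝔤, d (f 1 (exteriorPower.ιMulti ℝ 1 (fun _ => x))) = - contract (v x) ω

end Actions

end Multisymplectic

end

/-!
On a form `α` preserved by the action, Cartan's formula `L_V = d ι_V + ι_V d` and
`[L_V, ι_W] = ι_[V, W]` give, by induction on `p = q ∧ x` through `ι(v_p) = ι_{v_x} ι(v_q)`,
`d ι(v_p) α = (-1)^k (ι(v_p) dα + ι(v_∂p) α)` for `p ∈ Λ^k 𝔤`. The grade involution of `Λ 𝔤` absorbs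
all these signs, so that the identity makes sense for inhomogeneous `p`.

For `∂p = 0` and `dH = -ι_{v_H} ω`, this formula with `α = H` reads
`d ι(v_p) H = -ι_{v_H} ι(v_p) ω`. Since `d f_k(p) = -ς(k) ι(v_p) ω` on cycles, the term
`ι_{v_H} d f_k(p)` of `L_{v_H} f_k(p)` is `d (ς(k) ι(v_p) H)`.
-/

namespace Multisymplectic

section AlternatingMap

open ContinuousAlternatingMap

variable {𝕜 E F : Type*} [NontriviallyNormedField 𝕜] [NormedAddCommGroup E] [NormedSpace 𝕜 E]
  [NormedAddCommGroup F] [NormedSpace 𝕜 F] {k : ℕ}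

lemma curryLeft_curryLeft_comm (f : E [⋀^Fin (k + 2)]→L[𝕜] F) (u w : E) :
    (f.curryLeft u).curryLeft w = -(f.curryLeft w).curryLeft u := by
  have h := f.curryLeft_same (u + w)
  rw [map_add f.curryLeft, curryLeft_add, _root_.add_apply, map_add, map_add,
    curryLeft_same, curryLeft_same, zero_add, add_zero] at h
  exact eq_neg_of_add_eq_zero_left h

lemma curryLeft_alternatizeUncurryFin (A : E →L[𝕜] E [⋀^Fin (k + 1)]→L[𝕜] F) (u : E) :
    (alternatizeUncurryFin A).curryLeft u =
      A u - alternatizeUncurryFin ((curryLeftLI.toContinuousLinearMap ∘L A).flip u) := by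
  ext w
  have removeNth_vecCons (i : Fin (k + 1)) :
      i.succ.removeNth (Matrix.vecCons u w : Fin (k + 2) → E) =
        Matrix.vecCons u (i.removeNth w) := by
    ext j
    refine Fin.cases ?_ (fun j => ?_) j <;> simp [Fin.removeNth]
  simp [alternatizeUncurryFin_apply, Fin.sum_univ_succ, removeNth_vecCons, pow_succ,
    sub_eq_add_neg]

lemma fderivCompContinuousLinearMap_id_apply (f : E [⋀^Fin (k + 1)]→L[𝕜] F) (A : E →L[𝕜] E) :
    f.fderivCompContinuousLinearMap (.id 𝕜 E) A = alternatizeUncurryFin (f.curryLeft ∘L A) := by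
  rw [fderivCompContinuousLinearMap_eq_alternatizeUncurryFin]
  ext w
  simp [alternatizeUncurryFin_apply]

lemma curryLeft_fderivCompContinuousLinearMap_id (f : E [⋀^Fin (k + 1)]→L[𝕜] F) (A : E →L[𝕜] E)
    (u : E) :
    (f.fderivCompContinuousLinearMap (.id 𝕜 E) A).curryLeft u =
      (f.curryLeft u).fderivCompContinuousLinearMap (.id 𝕜 E) A + f.curryLeft (A u) := by
  rw [fderivCompContinuousLinearMap_id_apply]
  cases k with
  | zero =>
    ext w
    simp [alternatizeUncurryFin_apply]
  | succ k =>
    have flip_eq : (curryLeftLI.toContinuousLinearMap ∘L (f.curryLeft ∘L A)).flip u =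
        (-1 : 𝕜) • ((f.curryLeft u).curryLeft ∘L A) := by
      ext1 w
      simpa using! curryLeft_curryLeft_comm f (A w) u
    rw [curryLeft_alternatizeUncurryFin, flip_eq, alternatizeUncurryFin_smul,
      ← fderivCompContinuousLinearMap_id_apply]
    simp [add_comm]

end AlternatingMap

section Calculus

open ContinuousAlternatingMap

variable {𝕜 D E F : Type*} [NontriviallyNormedField 𝕜] [NormedAddCommGroup D] [NormedSpace 𝕜 D]
  [NormedAddCommGroup E] [NormedSpace 𝕜 E] [NormedAddCommGroup F] [NormedSpace 𝕜 F] {k : ℕ}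

lemma fderiv_curryLeft {V : D → E} {β : D → E [⋀^Fin (k + 1)]→L[𝕜] F} {y : D}
    (hβ : DifferentiableAt 𝕜 β y) (hV : DifferentiableAt 𝕜 V y) :
    fderiv 𝕜 (fun z => (β z).curryLeft (V z)) y =
      (β y).curryLeft ∘L fderiv 𝕜 V y +
        (curryLeftLI.toContinuousLinearMap ∘L fderiv 𝕜 β y).flip (V y) := by
  let curry : (E [⋀^Fin (k + 1)]→L[𝕜] F) →L[𝕜] E →L[𝕜] E [⋀^Fin k]→L[𝕜] F :=
    curryLeftLI.toContinuousLinearMap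
  have hcurry : HasFDerivAt (fun z => curry (β z)) (curry ∘L fderiv 𝕜 β y) y :=
    HasFDerivAt.comp (g := curry) y (ContinuousLinearMap.hasFDerivAt curry) hβ.hasFDerivAt
  exact (hcurry.clm_apply hV.hasFDerivAt).fderiv

end Calculus

section LieDerivModel

open ContinuousAlternatingMap

variable {E : Type*} [NormedAddCommGroup E] [NormedSpace ℝ E] {k : ℕ}

lemma lieDerivModel_congr (V : E → E) {β γ : E → E [⋀^Fin k]→L[ℝ] ℝ} {y : E}
    (h : β =ᶠ[nhds y] γ) : lieDerivModel V β y = lieDerivModel V γ y := by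
  rw [lieDerivModel, lieDerivModel, h.fderiv_eq, h.eq_of_nhds]

lemma lieDerivModel_add (V : E → E) {β γ : E → E [⋀^Fin k]→L[ℝ] ℝ} {y : E}
    (hβ : DifferentiableAt ℝ β y) (hγ : DifferentiableAt ℝ γ y) :
    lieDerivModel V (β + γ) y = lieDerivModel V β y + lieDerivModel V γ y := by
  ext w
  simp only [lieDerivModel, fderiv_add hβ hγ, fderivCompContinuousLinearMap_apply, Pi.add_apply,
    ContinuousAlternatingMap.add_apply, _root_.add_apply, Finset.sum_add_distrib]
  ring

lemma lieDerivModel_smul (V : E → E) (c : ℝ) (β : E → E [⋀^Fin k]→L[ℝ] ℝ) (y : E) :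
    lieDerivModel V (c • β) y = c • lieDerivModel V β y := by
  have fderiv_smul : fderiv ℝ (c • β) y = c • fderiv ℝ β y :=
    congrFun (fderiv_const_smul_field (𝕜 := ℝ) (f := β) c) y
  ext w
  simp [lieDerivModel, fderiv_smul, fderivCompContinuousLinearMap_apply, Finset.mul_sum]

lemma lieDerivModel_eq_curryLeft_extDeriv (V : E → E) (β : E → E [⋀^Fin 0]→L[ℝ] ℝ) (y : E) :
    lieDerivModel V β y = (extDeriv β y).curryLeft (V y) := by
  ext w
  simp [lieDerivModel, extDeriv, alternatizeUncurryFin_apply]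

lemma lieDerivModel_eq_extDeriv_curryLeft_add {V : E → E} {β : E → E [⋀^Fin (k + 1)]→L[ℝ] ℝ}
    {y : E} (hV : DifferentiableAt ℝ V y) (hβ : DifferentiableAt ℝ β y) :
    lieDerivModel V β y =
      extDeriv (fun z => (β z).curryLeft (V z)) y + (extDeriv β y).curryLeft (V y) := by
  rw [lieDerivModel, fderivCompContinuousLinearMap_id_apply, extDeriv, extDeriv,
    fderiv_curryLeft hβ hV, alternatizeUncurryFin_add, curryLeft_alternatizeUncurryFin]
  abel

lemma lieDerivModel_curryLeft {V W : E → E} {β : E → E [⋀^Fin (k + 1)]→L[ℝ] ℝ} {y : E}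
    (hW : DifferentiableAt ℝ W y) (hβ : DifferentiableAt ℝ β y) :
    lieDerivModel V (fun z => (β z).curryLeft (W z)) y =
      (lieDerivModel V β y).curryLeft (W y) +
        (β y).curryLeft (VectorField.lieBracket ℝ V W y) := by
  have leibniz : fderiv ℝ (fun z => (β z).curryLeft (W z)) y (V y) =
      (β y).curryLeft (fderiv ℝ W y (V y)) + (fderiv ℝ β y (V y)).curryLeft (W y) := by
    rw [fderiv_curryLeft hβ hW]
    rfl
  rw [lieDerivModel, lieDerivModel, leibniz, curryLeft_add, _root_.add_apply,
    curryLeft_fderivCompContinuousLinearMap_id, VectorField.lieBracket, map_sub]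
  abel

end LieDerivModel

section Chart

variable {E : Type*} [NormedAddCommGroup E] [NormedSpace ℝ E]
  {M : Type*} [TopologicalSpace M] [ChartedSpace E M] [IsManifold 𝓘(ℝ, E) (⊤ : ℕ∞) M]

lemma isInvertible_mfderiv_extChartAt_symm {x : M} {y : E}
    (hy : y ∈ (extChartAt 𝓘(ℝ, E) x).target) :
    (mfderiv 𝓘(ℝ, E) 𝓘(ℝ, E) (extChartAt 𝓘(ℝ, E) x).symm y).IsInvertible := by
  have h := isInvertible_mfderivWithin_extChartAt_symm (I := 𝓘(ℝ, E)) hy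
  rwa [ModelWithCorners.range_eq_univ, mfderivWithin_univ] at h

lemma mfderiv_extChartAt_symm_self (x : M) :
    mfderiv 𝓘(ℝ, E) 𝓘(ℝ, E) (extChartAt 𝓘(ℝ, E) x).symm (extChartAt 𝓘(ℝ, E) x x) =
      ContinuousLinearMap.id ℝ E := by
  have h := mfderivWithin_range_extChartAt_symm (I := 𝓘(ℝ, E)) (x := x)
  rwa [ModelWithCorners.range_eq_univ, mfderivWithin_univ] at h

lemma pullChart_eq {k : ℕ} (x : M) (β : E → E [⋀^Fin k]→L[ℝ] ℝ) :
    pullChart x β = β (extChartAt 𝓘(ℝ, E) x x) := by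
  exact congrArg (β _).compContinuousLinearMap (mfderiv_extChartAt_self (I := 𝓘(ℝ, E)) (x := x))

lemma chartForm_extChartAt_self {k : ℕ} (x : M) (α : M → E [⋀^Fin k]→L[ℝ] ℝ) :
    chartForm x α (extChartAt 𝓘(ℝ, E) x x) = α x := by
  refine (congrArg (ContinuousAlternatingMap.compContinuousLinearMap _)
    (mfderiv_extChartAt_symm_self x)).trans ?_
  exact congrArg α (extChartAt_to_inv x)

lemma chartField_extChartAt_self (x : M) (V : VField E M) :
    chartField x V (extChartAt 𝓘(ℝ, E) x x) = V x := by
  have inverse_eq : (mfderiv 𝓘(ℝ, E) 𝓘(ℝ, E) (extChartAt 𝓘(ℝ, E) x).symm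
      (extChartAt 𝓘(ℝ, E) x x)).inverse = ContinuousLinearMap.id ℝ E :=
    (congrArg (fun A : E →L[ℝ] E => A.inverse) (mfderiv_extChartAt_symm_self x)).trans
      ContinuousLinearMap.inverse_id
  exact (DFunLike.congr_fun inverse_eq _).trans
    (congrArg (fun z => (V z : E)) (extChartAt_to_inv x))

lemma mlieBracket_eq_lieBracket_chartField (x : M) (V W : VField E M) :
    VectorField.mlieBracket 𝓘(ℝ, E) V W x =
      VectorField.lieBracket ℝ (chartField x V) (chartField x W) (extChartAt 𝓘(ℝ, E) x x) := by
  have inverse_eq : (mfderiv 𝓘(ℝ, E) 𝓘(ℝ, E) (extChartAt 𝓘(ℝ, E) x) x).inverse =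
      ContinuousLinearMap.id ℝ E :=
    (congrArg (fun A : E →L[ℝ] E => A.inverse)
      (mfderiv_extChartAt_self (I := 𝓘(ℝ, E)) (x := x))).trans
      ContinuousLinearMap.inverse_id
  rw [VectorField.mlieBracket, VectorField.mlieBracketWithin_apply]
  refine (DFunLike.congr_fun inverse_eq _).trans ?_
  simp only [ModelWithCorners.range_eq_univ, Set.preimage_univ, Set.univ_inter,
    VectorField.mpullbackWithin_univ]
  exact congrFun (VectorField.lieBracketWithin_univ (𝕜 := ℝ) (E := E)) _

lemma chartForm_contract (V : VField E M) (α : Form E M) (k : ℕ) {x : M} {y : E}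
    (hy : y ∈ (extChartAt 𝓘(ℝ, E) x).target) :
    chartForm x (contract V α k) y =
      (chartForm x (α (k + 1)) y).curryLeft (chartField x V y) := by
  have self_apply_inverse := (isInvertible_mfderiv_extChartAt_symm hy).self_apply_inverse
    (V ((extChartAt 𝓘(ℝ, E) x).symm y))
  refine Eq.trans ?_ (ContinuousAlternatingMap.curryLeft_compContinuousLinearMap _ _ _).symm
  change ((α (k + 1) _).curryLeft (V _)).compContinuousLinearMap _ = _
  congr 2
  exact self_apply_inverse.symm

lemma chartForm_contract_eventuallyEq (V : VField E M) (α : Form E M) (k : ℕ) (x : M) :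
    chartForm x (contract V α k) =ᶠ[nhds (extChartAt 𝓘(ℝ, E) x x)]
      fun y => (chartForm x (α (k + 1)) y).curryLeft (chartField x V y) :=
  Filter.eventually_of_mem (extChartAt_target_mem_nhds x) fun _ hy => chartForm_contract V α k hy

lemma VField.IsSmooth.contDiffOn_chartField [CompleteSpace E] {V : VField E M} (hV : V.IsSmooth)
    (x : M) : ContDiffOn ℝ (⊤ : ℕ∞) (chartField x V) (extChartAt 𝓘(ℝ, E) x).target := by
  intro y hy
  have hsymm : ContMDiffAt 𝓘(ℝ, E) 𝓘(ℝ, E) (⊤ : ℕ∞) (extChartAt 𝓘(ℝ, E) x).symm y :=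
    (contMDiffOn_extChartAt_symm x).contMDiffAt ((isOpen_extChartAt_target x).mem_nhds hy)
  have : IsManifold 𝓘(ℝ, E) (((⊤ : ℕ∞) : WithTop ℕ∞) + 1) M := by
    simpa using ‹IsManifold 𝓘(ℝ, E) (⊤ : ℕ∞) M›
  refine (contMDiffAt_vectorSpace_iff_contDiffAt.1 ?_).contDiffWithinAt
  exact ContMDiffAt.mpullback_vectorField_preimage (n := (⊤ : ℕ∞)) (hV _) hsymm
    (isInvertible_mfderiv_extChartAt_symm hy) (by simp)

lemma VField.IsSmooth.differentiableAt_chartField [CompleteSpace E] {V : VField E M}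
    (hV : V.IsSmooth) (x : M) :
    DifferentiableAt ℝ (chartField x V) (extChartAt 𝓘(ℝ, E) x x) :=
  ((hV.contDiffOn_chartField x).contDiffAt (extChartAt_target_mem_nhds x)).differentiableAt
    (by simp)

end Chart

section CartanCalculus

variable {E : Type*} [NormedAddCommGroup E] [NormedSpace ℝ E]
  {M : Type*} [TopologicalSpace M] [ChartedSpace E M] {α β : Form E M} {V W : VField E M}

lemma Form.IsSmooth.differentiableAt_chartForm (hα : α.IsSmooth) (k : ℕ) (x : M) :
    DifferentiableAt ℝ (chartForm x (α k)) (extChartAt 𝓘(ℝ, E) x x) :=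
  ((hα k x).contDiffAt (extChartAt_target_mem_nhds x)).differentiableAt (by simp)

lemma Form.IsSmooth.add (hα : α.IsSmooth) (hβ : β.IsSmooth) : (α + β).IsSmooth :=
  fun k x => (hα k x).add (hβ k x)

lemma Form.IsSmooth.const_smul (c : ℝ) (hα : α.IsSmooth) : (c • α).IsSmooth :=
  fun k x => (hα k x).const_smul c

lemma d_add (hα : α.IsSmooth) (hβ : β.IsSmooth) : d (α + β) = d α + d β := by
  funext k x
  cases k with
  | zero => exact (add_zero _).symm
  | succ k =>
    change pullChart x (extDeriv (chartForm x (α k) + chartForm x (β k))) = _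
    rw [pullChart, extDeriv_add (hα.differentiableAt_chartForm k x)
      (hβ.differentiableAt_chartForm k x)]
    rfl

lemma d_smul (c : ℝ) (α : Form E M) : d (c • α) = c • d α := by
  funext k x
  cases k with
  | zero => exact (smul_zero c).symm
  | succ k =>
    change pullChart x (extDeriv (c • chartForm x (α k))) = _
    rw [pullChart, extDeriv_smul]
    rfl

lemma lieDeriv_add (V : VField E M) (hα : α.IsSmooth) (hβ : β.IsSmooth) :
    lieDeriv V (α + β) = lieDeriv V α + lieDeriv V β := by
  funext k x
  change pullChart x (lieDerivModel _ (chartForm x (α k) + chartForm x (β k))) = _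
  rw [pullChart, lieDerivModel_add _ (hα.differentiableAt_chartForm k x)
    (hβ.differentiableAt_chartForm k x)]
  rfl

lemma lieDeriv_smul (V : VField E M) (c : ℝ) (α : Form E M) :
    lieDeriv V (c • α) = c • lieDeriv V α := by
  funext k x
  change pullChart x (lieDerivModel _ (c • chartForm x (α k))) = _
  rw [pullChart, lieDerivModel_smul]
  rfl

lemma contract_contract_comm (V W : VField E M) (α : Form E M) :
    contract V (contract W α) = -contract W (contract V α) := by
  funext k x
  exact curryLeft_curryLeft_comm (α (k + 2) x) (W x) (V x)

variable [IsManifold 𝓘(ℝ, E) (⊤ : ℕ∞) M]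

lemma d_succ_apply (α : Form E M) (k : ℕ) (x : M) :
    d α (k + 1) x = extDeriv (chartForm x (α k)) (extChartAt 𝓘(ℝ, E) x x) :=
  pullChart_eq x _

lemma lieDeriv_apply (V : VField E M) (α : Form E M) (k : ℕ) (x : M) :
    lieDeriv V α k x =
      lieDerivModel (chartField x V) (chartForm x (α k)) (extChartAt 𝓘(ℝ, E) x x) :=
  pullChart_eq x _

variable [CompleteSpace E]

lemma Form.IsSmooth.contract (hV : V.IsSmooth) (hα : α.IsSmooth) : (contract V α).IsSmooth := by
  intro k x
  refine ContDiffOn.congr ?_ fun y hy => chartForm_contract V α k hy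
  exact (ContinuousAlternatingMap.curryLeftLI.toContinuousLinearMap.contDiff.comp_contDiffOn
    (hα (k + 1) x)).clm_apply (hV.contDiffOn_chartField x)

theorem lieDeriv_eq_d_contract_add_contract_d (hV : V.IsSmooth) (hα : α.IsSmooth) :
    lieDeriv V α = d (contract V α) + contract V (d α) := by
  funext k x
  have contract_d : contract V (d α) k x =
      (extDeriv (chartForm x (α k)) (extChartAt 𝓘(ℝ, E) x x)).curryLeft
        (chartField x V (extChartAt 𝓘(ℝ, E) x x)) := by
    rw [chartField_extChartAt_self, ← d_succ_apply]
    rfl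
  rw [lieDeriv_apply, Pi.add_apply, Pi.add_apply, contract_d]
  cases k with
  | zero => exact (lieDerivModel_eq_curryLeft_extDeriv _ _ _).trans (zero_add _).symm
  | succ k =>
    rw [d_succ_apply, (chartForm_contract_eventuallyEq V α k x).extDeriv_eq]
    exact lieDerivModel_eq_extDeriv_curryLeft_add (hV.differentiableAt_chartField x)
      (hα.differentiableAt_chartForm (k + 1) x)

theorem lieDeriv_contract (V : VField E M) (hW : W.IsSmooth) (hα : α.IsSmooth) :
    lieDeriv V (contract W α) =
      contract W (lieDeriv V α) + contract (VectorField.mlieBracket 𝓘(ℝ, E) V W) α := by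
  funext k x
  rw [lieDeriv_apply, lieDerivModel_congr _ (chartForm_contract_eventuallyEq W α k x),
    lieDerivModel_curryLeft (hW.differentiableAt_chartField x)
      (hα.differentiableAt_chartForm (k + 1) x), ← lieDeriv_apply, chartForm_extChartAt_self,
    chartField_extChartAt_self, ← mlieBracket_eq_lieBracket_chartField]
  rfl

end CartanCalculus

section GradeInvolution

open ExteriorAlgebra CliffordAlgebra

variable {R L : Type*} [CommRing R] [AddCommGroup L] [Module R L]

lemma involute_ι_mul (x : L) (q : ExteriorAlgebra R L) :
    involute (ExteriorAlgebra.ι R x * q) = -(ExteriorAlgebra.ι R x * involute q) := by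
  rw [map_mul, involute_ι, neg_mul]

lemma mul_ι_eq_ι_mul_involute (q : ExteriorAlgebra R L) (x : L) :
    q * ExteriorAlgebra.ι R x = ExteriorAlgebra.ι R x * involute q := by
  induction q using left_induction with
  | algebraMap c => rw [AlgHom.commutes, Algebra.commutes]
  | add p q hp hq => rw [add_mul, hp, hq, map_add, mul_add]
  | ι_mul q y hq =>
    have anticomm : ExteriorAlgebra.ι R y * ExteriorAlgebra.ι R x =
        -(ExteriorAlgebra.ι R x * ExteriorAlgebra.ι R y) :=
      eq_neg_of_add_eq_zero_left (ι_add_mul_swap y x)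
    rw [mul_assoc, hq, involute_ι_mul, ← mul_assoc, anticomm, neg_mul, mul_assoc, mul_neg]

end GradeInvolution

section Derivations

open ExteriorAlgebra CliffordAlgebra

variable {𝔤 : Type*} [LieRing 𝔤] [LieAlgebra ℝ 𝔤]

lemma adExt_algebraMap (c : ℝ) (x : 𝔤) : adExt 𝔤 (algebraMap ℝ _ c) x = 0 := by
  rw [Algebra.algebraMap_eq_smul_one, map_smul, LinearMap.smul_apply, adExt_one, smul_zero]

lemma adExt_ι (x y : 𝔤) : adExt 𝔤 (ExteriorAlgebra.ι ℝ y) x = ExteriorAlgebra.ι ℝ ⁅x, y⁆ := by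
  simpa [adExt_one] using adExt_ι_mul 𝔤 x y 1

lemma adExt_mul (p q : ExteriorAlgebra ℝ 𝔤) (x : 𝔤) :
    adExt 𝔤 (p * q) x = adExt 𝔤 p x * q + p * adExt 𝔤 q x := by
  induction p using left_induction with
  | algebraMap c => simp [adExt_algebraMap, ← Algebra.smul_def]
  | add p₁ p₂ h₁ h₂ =>
    simp only [add_mul, map_add, LinearMap.add_apply, h₁, h₂]
    abel
  | ι_mul p y hp =>
    rw [mul_assoc, adExt_ι_mul, adExt_ι_mul, hp]
    noncomm_ring

lemma lieDiff_algebraMap (c : ℝ) : lieDiff 𝔤 (algebraMap ℝ _ c) = 0 := by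
  rw [Algebra.algebraMap_eq_smul_one, map_smul, lieDiff_one, smul_zero]

lemma lieDiff_ι (x : 𝔤) : lieDiff 𝔤 (ExteriorAlgebra.ι ℝ x) = 0 := by
  simpa [lieDiff_one, adExt_one] using lieDiff_ι_mul 𝔤 x 1

lemma lieDiff_mul_ι (q : ExteriorAlgebra ℝ 𝔤) (x : 𝔤) :
    lieDiff 𝔤 (q * ExteriorAlgebra.ι ℝ x) =
      lieDiff 𝔤 q * ExteriorAlgebra.ι ℝ x - involute (adExt 𝔤 q x) := by
  induction q using left_induction with
  | algebraMap c =>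
    rw [← Algebra.smul_def, map_smul, lieDiff_ι, lieDiff_algebraMap, adExt_algebraMap]
    simp
  | add p q hp hq =>
    simp only [add_mul, map_add, LinearMap.add_apply, hp, hq]
    abel
  | ι_mul q y hq =>
    rw [mul_assoc, lieDiff_ι_mul, hq, adExt_mul, adExt_ι, mul_ι_eq_ι_mul_involute q,
      lieDiff_ι_mul, adExt_ι_mul, map_add, involute_ι_mul, involute_ι_mul, ← lie_skew x y, map_neg]
    noncomm_ring

lemma lieDiff_eq_zero_of_mem_lieCycles {k : ℕ} {p : ⋀[ℝ]^k 𝔤} (hp : p ∈ lieCycles 𝔤 k) :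
    lieDiff 𝔤 p = 0 :=
  congrArg Subtype.val (show lieBoundary 𝔤 k p = 0 from hp)

end Derivations

section MultiContraction

open ExteriorAlgebra CliffordAlgebra

variable {E : Type*} [NormedAddCommGroup E] [NormedSpace ℝ E]
  {M : Type*} [TopologicalSpace M] [ChartedSpace E M]
  {𝔤 : Type*} [LieRing 𝔤] [LieAlgebra ℝ 𝔤]

section

variable (v : 𝔤 →ₗ[ℝ] VField E M)

lemma contractMulti_zero : contractMulti v 0 = 0 := by
  simp [contractMulti]

lemma contractMulti_add (p q : ExteriorAlgebra ℝ 𝔤) :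
    contractMulti v (p + q) = contractMulti v p + contractMulti v q := by
  simp [contractMulti]

lemma contractMulti_neg (p : ExteriorAlgebra ℝ 𝔤) :
    contractMulti v (-p) = -contractMulti v p := by
  simp [contractMulti]

lemma contractMulti_algebraMap (c : ℝ) (α : Form E M) :
    contractMulti v (algebraMap ℝ (ExteriorAlgebra ℝ 𝔤) c) α = c • α := by
  simp [contractMulti]

lemma contractMulti_ι (x : 𝔤) : contractMulti v (ExteriorAlgebra.ι ℝ x) = contract (v x) := by
  rw [contractMulti, lift_ι_apply]
  rfl

lemma contractMulti_mul (p q : ExteriorAlgebra ℝ 𝔤) :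
    contractMulti v (p * q) = contractMulti v q * contractMulti v p := by
  simp [contractMulti]

lemma contractMulti_ι_mul (x : 𝔤) (q : ExteriorAlgebra ℝ 𝔤) (α : Form E M) :
    contractMulti v (ExteriorAlgebra.ι ℝ x * q) α = contractMulti v q (contract (v x) α) := by
  rw [contractMulti_mul, contractMulti_ι, Module.End.mul_apply]

lemma contractMulti_mul_ι (q : ExteriorAlgebra ℝ 𝔤) (x : 𝔤) (α : Form E M) :
    contractMulti v (q * ExteriorAlgebra.ι ℝ x) α = contract (v x) (contractMulti v q α) := by
  rw [contractMulti_mul, contractMulti_ι, Module.End.mul_apply]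

lemma contract_contractMulti (W : VField E M) (q : ExteriorAlgebra ℝ 𝔤) (α : Form E M) :
    contract W (contractMulti v q α) = contractMulti v (involute q) (contract W α) := by
  induction q using left_induction generalizing α with
  | algebraMap c =>
    rw [AlgHom.commutes, contractMulti_algebraMap, contractMulti_algebraMap, map_smul]
  | add p q hp hq =>
    simp only [map_add, contractMulti_add, LinearMap.add_apply, hp, hq]
  | ι_mul q x hq =>
    rw [contractMulti_ι_mul, hq, contract_contract_comm, involute_ι_mul, contractMulti_neg,
      LinearMap.neg_apply, contractMulti_ι_mul, map_neg]

end

variable [IsManifold 𝓘(ℝ, E) (⊤ : ℕ∞) M] {v : 𝔤 →ₗ[ℝ] VField E M}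

lemma IsLInftyMorphism.d_eq_of_mem_lieCycles {n k : ℕ} {ω : Form E M}
    {f : ∀ k : ℕ, ⋀[ℝ]^k 𝔤 →ₗ[ℝ] Form E M} (hf : IsLInftyMorphism n ω v f) (hk : 1 ≤ k)
    (hkn : k ≤ n + 1) {p : ⋀[ℝ]^k 𝔤} (hp : p ∈ lieCycles 𝔤 k) :
    d (f k p) = -(varsigma k • contractMulti v p ω) := by
  have h := hf.eq k hk hkn p
  rw [show lieBoundary 𝔤 k p = 0 from hp, map_zero, neg_zero] at h
  exact eq_neg_of_add_eq_zero_left h.symm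

variable [CompleteSpace E] {α : Form E M}

lemma Form.IsSmooth.contractMulti (hv : ∀ x, (v x).IsSmooth) (p : ExteriorAlgebra ℝ 𝔤)
    (hα : α.IsSmooth) : (contractMulti v p α).IsSmooth := by
  induction p using right_induction with
  | algebraMap c => exact contractMulti_algebraMap v c α ▸ hα.const_smul c
  | add p q hp hq => exact contractMulti_add v p q ▸ hp.add hq
  | mul_ι x q hq => exact contractMulti_mul_ι v q x α ▸ hq.contract (hv x)

theorem lieDeriv_contractMulti (hv : ∀ x, (v x).IsSmooth)
    (hlie : ∀ x y, v ⁅x, y⁆ = VectorField.mlieBracket 𝓘(ℝ, E) (v x) (v y)) (x : 𝔤)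
    (q : ExteriorAlgebra ℝ 𝔤) (hα : α.IsSmooth) :
    lieDeriv (v x) (contractMulti v q α) =
      contractMulti v q (lieDeriv (v x) α) + contractMulti v (adExt 𝔤 q x) α := by
  induction q using right_induction with
  | algebraMap c =>
    rw [contractMulti_algebraMap, contractMulti_algebraMap, lieDeriv_smul, adExt_algebraMap,
      contractMulti_zero, LinearMap.zero_apply, add_zero]
  | add p q hp hq =>
    simp only [contractMulti_add, LinearMap.add_apply, map_add, hp, hq,
      lieDeriv_add _ (hα.contractMulti hv p) (hα.contractMulti hv q)]
    abel
  | mul_ι y q hq =>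
    rw [contractMulti_mul_ι, lieDeriv_contract _ (hv y) (hα.contractMulti hv q), ← hlie, hq,
      adExt_mul, adExt_ι, contractMulti_add, LinearMap.add_apply, contractMulti_mul_ι,
      contractMulti_mul_ι, contractMulti_mul_ι, map_add, add_assoc]

theorem d_contractMulti (hv : ∀ x, (v x).IsSmooth)
    (hlie : ∀ x y, v ⁅x, y⁆ = VectorField.mlieBracket 𝓘(ℝ, E) (v x) (v y))
    (hpres : IsStrictlyPreserving v α) (p : ExteriorAlgebra ℝ 𝔤) (hα : α.IsSmooth) :
    d (contractMulti v p α) =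
      contractMulti v (involute p) (d α) - contractMulti v (involute (lieDiff 𝔤 p)) α := by
  induction p using right_induction with
  | algebraMap c =>
    rw [AlgHom.commutes, contractMulti_algebraMap, contractMulti_algebraMap, d_smul,
      lieDiff_algebraMap, map_zero, contractMulti_zero, LinearMap.zero_apply, sub_zero]
  | add p q hp hq =>
    simp only [contractMulti_add, LinearMap.add_apply, map_add, hp, hq,
      d_add (hα.contractMulti hv p) (hα.contractMulti hv q)]
    abel
  | mul_ι x q hq =>
    have cartan := lieDeriv_eq_d_contract_add_contract_d (hv x) (hα.contractMulti hv q)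
    rw [lieDeriv_contractMulti hv hlie x q hα, hpres x, map_zero, zero_add,
      ← sub_eq_iff_eq_add] at cartan
    rw [contractMulti_mul_ι, ← cartan, hq, lieDiff_mul_ι]
    simp only [map_mul, involute_ι, involute_involute, mul_neg, contractMulti_neg,
      sub_eq_add_neg, contractMulti_add, LinearMap.add_apply, LinearMap.neg_apply,
      contractMulti_mul_ι, map_add, map_neg]
    abel

end MultiContraction

end Multisymplectic

open Multisymplectic in
theorem mainTheorem1_general
    {E : Type*} [NormedAddCommGroup E] [NormedSpace ℝ E] [CompleteSpace E]
    {M : Type*} [TopologicalSpace M] [ChartedSpace E M] [IsManifold 𝓘(ℝ, E) (⊤ : ℕ∞) M]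
    {𝔤 : Type*} [LieRing 𝔤] [LieAlgebra ℝ 𝔤]
    {ω H α : Form E M} {vH : VField E M} (hvH : IsHamiltonianField ω H vH) (hH : H.IsSmooth)
    {v : 𝔤 →ₗ[ℝ] VField E M} (hv : ∀ x, (v x).IsSmooth)
    (hlie : ∀ x y, v ⁅x, y⁆ = VectorField.mlieBracket 𝓘(ℝ, E) (v x) (v y))
    (hpres : IsStrictlyPreserving v H) {p : ExteriorAlgebra ℝ 𝔤} (hp : lieDiff 𝔤 p = 0)
    (hα : α.IsSmooth) {c : ℝ} (hdα : d α = -(c • contractMulti v p ω)) :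
    IsGloballyConserved vH α ∧
      lieDeriv vH α = d (contract vH α + c • contractMulti v p H) := by
  have hvHα := hα.contract hvH.smooth
  have hpH := (hH.contractMulti hv p).const_smul c
  have d_contractMulti_H : d (contractMulti v p H) = -contract vH (contractMulti v p ω) := by
    rw [d_contractMulti hv hlie hpres p hH, hp, map_zero, contractMulti_zero,
      LinearMap.zero_apply, sub_zero, hvH.eq, map_neg, contract_contractMulti]
  have lieDeriv_eq : lieDeriv vH α = d (contract vH α + c • contractMulti v p H) := by
    rw [lieDeriv_eq_d_contract_add_contract_d hvH.smooth hα, hdα, d_add hvHα hpH, d_smul,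
      d_contractMulti_H, map_neg, map_smul, smul_neg]
  exact ⟨⟨_, hvHα.add hpH, lieDeriv_eq⟩, lieDeriv_eq⟩

open Multisymplectic in
theorem mainTheorem1
    {E : Type*} [NormedAddCommGroup E] [NormedSpace ℝ E] [FiniteDimensional ℝ E]
    {M : Type*} [TopologicalSpace M] [ChartedSpace E M] [IsManifold 𝓘(ℝ, E) (⊤ : ℕ∞) M]
    {𝔤 : Type*} [LieRing 𝔤] [LieAlgebra ℝ 𝔤]
    (n : ℕ) (ω : Form E M) (hω : IsPrePlectic n ω)
    (H : Form E M) (hH : IsHamiltonianForm n ω H)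
    (vH : VField E M) (hvH : IsHamiltonianField ω H vH)
    (v : 𝔤 →ₗ[ℝ] VField E M) (hv : IsMultisymplecticAction ω v)
    (hvH_pres : IsStrictlyPreserving v H)
    (f : ∀ k : ℕ, ⋀[ℝ]^k 𝔤 →ₗ[ℝ] Form E M) (hf : IsComomentumMap n ω v f)
    (k : ℕ) (hk : 1 ≤ k) (hkn : k ≤ n) (p : ⋀[ℝ]^k 𝔤) (hp : p ∈ lieCycles 𝔤 k) :
    IsGloballyConserved vH (f k p) ∧
      lieDeriv vH (f k p) =
        d (contract vH (f k p) + varsigma k • contractMulti v p H) := by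
  have : CompleteSpace E := FiniteDimensional.complete ℝ E
  exact mainTheorem1_general hvH hH.form.smooth hv.smooth hv.map_lie hvH_pres
    (lieDiff_eq_zero_of_mem_lieCycles hp) (hf.form k hk hkn p).smooth
    (hf.d_eq_of_mem_lieCycles hk (Nat.le_succ_of_le hkn) hp)
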